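/- Let $H$ be a complex Hilbert space, and give $\mathbb{B}(H)$ its weak-$*$ (that is, $\sigma$-weak) topology. Definitions. For subspaces $E,F$ of a normed space and $\gamma>0$, write $E\subseteq^{\gamma}F$ if for every $x\in E$ with $\|x\|\le 1$ there is $y\in F$ with $\|x-y\|\le\gamma$. For subspaces $E,F\subset\mathbb{B}(H)$, write $E\subseteq^{\gamma}_{cb}F$ if $\mathbb{M}_n(E)\subseteq^{\gamma}\mathbb{M}_n(F)$ for all $n$, where $\mathbb{M}_n(E)\subset\mathbb{M}_n(\mathbb{B}(H))=\mathbb{B}(\ell^2_n\otimes H)$ carries the operator norm. Let $M\subset\mathbb{B}(H)$ be a $w^*$-closed subalgebra containing $I_H$, with its relative $w^*$-topology. Let $(M\widehat\otimes M)^*_\sigma$ be the space of bounded bilinear forms on $M\times M$ that are separately $w^*$-continuous, with norm $\|\psi\|=\sup_{\|x\|,\|y\|\le1}|\psi(x,y)|$. The normal projective tensor product is the dual Banach space $M\widehat\otimes_\sigma M=\big((M\widehat\otimes M)^*_\sigma\big)^*$, with the dual norm. It is an $M$-bimodule via $\langle a\cdot u\cdot b,\psi\rangle=\langle u,\,b\cdot\psi\cdot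 a\rangle$, where $(b\cdot\psi\cdot a)(c,d)=\psi(ac,db)$. The multiplication of $M$ induces a map $m_\sigma:M\widehat\otimes_\sigma M\to M$, determined by $f(m_\sigma(u))=\langle u,(x,y)\mapsto f(xy)\rangle$ for every $w^*$-continuous linear functional $f$ on $M$. A normal virtual diagonal for $M$ is an element $u\in M\widehat\otimes_\sigma M$ such that $m\cdot u=u\cdot m$ for all $m\in M$ and $m_\sigma(u)=1$. A von Neumann algebra $N\subset\mathbb{B}(H)$ is injective if there is a completely contractive linear projection from $\mathbb{B}(H)$ onto $N$. Lemma. Let $M\subset\mathbb{B}(H)$ be a $w^*$-closed subalgebra containing $I_H$ and admitting a normal virtual diagonal $u\in M\widehat\otimes_\sigma M$, and let $N\subset\mathbb{B}(H)$ be an injective von Neumann algebra. Then, for every $\gamma>0$, $$M\subseteq^{\gamma}N\quad\Longrightarrow\quad M\subseteq^{4\|u\|\gamma}_{cb}N .$$ -/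

import Mathlib

set_option maxSynthPendingDepth 3

open scoped InnerProductSpace Topology

noncomputable section

universe u

variable {H : Type u} [NormedAddCommGroup H] [InnerProductSpace ℂ H]

/-! ### The weak-star topology -/

variable (H) in
/-- The weak-star (ultraweak, `σ`-weak) topology of `B(H)`: the coarsest topology for which all the
functionals `T ↦ ∑ₙ ⟪ξₙ, T ηₙ⟫` with `∑ ‖ξₙ‖² < ∞` and `∑ ‖ηₙ‖² < ∞` are continuous. -/
@[reducible] def ultraweakTopology : TopologicalSpace (H →L[ℂ] H) :=
  ⨅ (ξ : ℕ → H) (η : ℕ → H) (_ : Summable fun n => ‖ξ n‖ ^ 2) (_ : Summable fun n => ‖η n‖ ^ 2),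
    TopologicalSpace.induced (fun T : H →L[ℂ] H => ∑' n, ⟪ξ n, T (η n)⟫_ℂ) inferInstance

/-- The weak-star topology of an operator algebra `M ⊆ B(H)`, i.e. the relative one. For weak-star
closed `M` this is the weak-star topology of `M` as a dual operator algebra. -/
@[reducible] def wstarTopology (M : Subalgebra ℂ (H →L[ℂ] H)) : TopologicalSpace M :=
  (ultraweakTopology H).induced Subtype.val

theorem summable_norm_sq_apply (A : H →L[ℂ] H) {ξ : ℕ → H} (h : Summable fun n => ‖ξ n‖ ^ 2) :
    Summable fun n => ‖A (ξ n)‖ ^ 2 := by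
  refine Summable.of_nonneg_of_le (fun n => by positivity) (fun n => ?_) (h.mul_left (‖A‖ ^ 2))
  rw [← mul_pow]
  gcongr
  exact A.le_opNorm _

theorem ultraweak_continuous_functional {ξ η : ℕ → H} (hξ : Summable fun n => ‖ξ n‖ ^ 2)
    (hη : Summable fun n => ‖η n‖ ^ 2) :
    @Continuous _ _ (ultraweakTopology H) inferInstance
      (fun T : H →L[ℂ] H => ∑' n, ⟪ξ n, T (η n)⟫_ℂ) := by
  rw [continuous_iff_le_induced]
  exact iInf_le_of_le ξ (iInf_le_of_le η (iInf_le_of_le hξ (iInf_le_of_le hη le_rfl)))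

theorem ultraweak_continuous_mul_mul [CompleteSpace H] (A B : H →L[ℂ] H) :
    @Continuous _ _ (ultraweakTopology H) (ultraweakTopology H)
      (fun T : H →L[ℂ] H => A * T * B) := by
  conv => arg @4; unfold ultraweakTopology
  refine continuous_iInf_rng.2 fun ξ => continuous_iInf_rng.2 fun η =>
    continuous_iInf_rng.2 fun hξ => continuous_iInf_rng.2 fun hη => continuous_induced_rng.2 ?_
  have h := ultraweak_continuous_functional
    (summable_norm_sq_apply (ContinuousLinearMap.adjoint A) hξ) (summable_norm_sq_apply B hη)
  have e : ((fun T : H →L[ℂ] H => ∑' n, ⟪ξ n, T (η n)⟫_ℂ) ∘ fun T : H →L[ℂ] H => A * T * B) =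
      fun T : H →L[ℂ] H => ∑' n, ⟪ContinuousLinearMap.adjoint A (ξ n), T (B (η n))⟫_ℂ := by
    funext T
    simp [ContinuousLinearMap.adjoint_inner_left]
  rw [e]
  exact h

theorem wstar_continuous_mul_mul [CompleteSpace H] (M : Subalgebra ℂ (H →L[ℂ] H)) (a b : M) :
    @Continuous _ _ (wstarTopology M) (wstarTopology M) (fun x : M => a * x * b) := by
  refine continuous_induced_rng.2 ?_
  exact @Continuous.comp _ _ _ (wstarTopology M) (ultraweakTopology H) (ultraweakTopology H) _ _
    (ultraweak_continuous_mul_mul (a : H →L[ℂ] H) (b : H →L[ℂ] H)) continuous_induced_dom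

/-- The predual `M_*` of an operator algebra `M ⊆ B(H)`: all weak-star continuous bounded linear
functionals on `M`. -/
def wstarPredual (M : Subalgebra ℂ (H →L[ℂ] H)) : Submodule ℂ (StrongDual ℂ M) where
  carrier := {f | Continuous[wstarTopology M, inferInstance] (fun x : M => f x)}
  add_mem' hf hg := @Continuous.add _ _ _ _ _ (wstarTopology M) _ _ hf hg
  zero_mem' := @continuous_const _ _ (wstarTopology M) _ _
  smul_mem' c _ hf := @Continuous.const_smul _ _ _ _ _ _ (wstarTopology M) _ hf c

/-! ### The normal projective tensor product and normal virtual diagonals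

Below `A` is a unital Banach algebra, and the subspace `P` of its dual space is its predual, i.e. the
space of all weak-star continuous functionals. The case of interest is a weak-star closed unital
algebra `M ⊆ B(H)` with `P = wstarPredual M`. -/

section Diagonal

variable {A : Type u} [NormedRing A] [NormedAlgebra ℂ A] (P : Submodule ℂ (StrongDual ℂ A))

/-- The space of all bounded bilinear forms on `A × A` which are separately weak-star continuous,
with the norm `‖ψ‖ = sup {|ψ(x, y)| : ‖x‖ ≤ 1, ‖y‖ ≤ 1}`. -/
def normalForms : Submodule ℂ (A →L[ℂ] A →L[ℂ] ℂ) where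
  carrier := {ψ | (∀ x : A, ψ x ∈ P) ∧ ∀ y : A, ψ.flip y ∈ P}
  add_mem' hf hg := ⟨fun x => P.add_mem (hf.1 x) (hg.1 x), fun y => P.add_mem (hf.2 y) (hg.2 y)⟩
  zero_mem' := ⟨fun _ => P.zero_mem, fun _ => P.zero_mem⟩
  smul_mem' c _ hf := ⟨fun x => P.smul_mem c (hf.1 x), fun y => P.smul_mem c (hf.2 y)⟩

/-- The normal projective tensor product of `A` with itself: the Banach space dual (with its dual
norm) of the space of separately weak-star continuous bounded bilinear forms. -/
abbrev NormalProjTensor : Type u := StrongDual ℂ (normalForms P)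

/-- Multiplication is separately weak-star continuous: `x ↦ f (a x)` and `x ↦ f (x a)` are
weak-star continuous for every weak-star continuous functional `f`. -/
def MulSeparatelyNormal : Prop :=
  ∀ f ∈ P, ∀ a : A, f.comp (ContinuousLinearMap.mul ℂ A a) ∈ P ∧
    f.comp ((ContinuousLinearMap.mul ℂ A).flip a) ∈ P

variable {P}

/-- The form `b · ψ · a : (c, d) ↦ ψ (a c, d b)`, as a bounded operator in `ψ`. -/
def normalForms.act (hP : MulSeparatelyNormal P) (a b : A) : normalForms P →L[ℂ] normalForms P :=
  LinearMap.mkContinuous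
    { toFun := fun ψ =>
        ⟨(ψ : A →L[ℂ] A →L[ℂ] ℂ).bilinearComp (ContinuousLinearMap.mul ℂ A a)
            ((ContinuousLinearMap.mul ℂ A).flip b),
          fun x => (hP _ (ψ.2.1 (a * x)) b).2, fun y => (hP _ (ψ.2.2 (y * b)) a).1⟩
      map_add' := fun _ _ => rfl
      map_smul' := fun _ _ => rfl }
    (‖a‖ * ‖b‖) (fun ψ => by
      refine ContinuousLinearMap.opNorm_le_bound₂ _ (by positivity) fun x y => ?_
      change ‖(ψ : A →L[ℂ] A →L[ℂ] ℂ) (a * x) (y * b)‖ ≤ ‖a‖ * ‖b‖ * ‖ψ‖ * ‖x‖ * ‖y‖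
      calc ‖(ψ : A →L[ℂ] A →L[ℂ] ℂ) (a * x) (y * b)‖
          ≤ ‖(ψ : A →L[ℂ] A →L[ℂ] ℂ)‖ * ‖a * x‖ * ‖y * b‖ :=
            ContinuousLinearMap.le_opNorm₂ _ _ _
        _ ≤ ‖(ψ : A →L[ℂ] A →L[ℂ] ℂ)‖ * (‖a‖ * ‖x‖) * (‖y‖ * ‖b‖) := by
            gcongr <;> exact norm_mul_le _ _
        _ = ‖a‖ * ‖b‖ * ‖ψ‖ * ‖x‖ * ‖y‖ := by
            rw [Submodule.coe_norm]; ring)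

theorem normalForms.act_apply (hP : MulSeparatelyNormal P) (a b : A) (ψ : normalForms P)
    (c d : A) : (normalForms.act hP a b ψ : A →L[ℂ] A →L[ℂ] ℂ) c d =
      (ψ : A →L[ℂ] A →L[ℂ] ℂ) (a * c) (d * b) := rfl

/-- The bimodule action `a · u · b` on the normal projective tensor product, dual to the action on
forms; on elementary tensors `a · (c ⊗ d) · b = a c ⊗ d b`. -/
def NormalProjTensor.act (hP : MulSeparatelyNormal P) (a b : A) (u : NormalProjTensor P) :
    NormalProjTensor P :=
  ContinuousLinearMap.comp u (normalForms.act hP a b)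

/-- The elementary tensor `c ⊗ d`, that is, evaluation of forms at `(c, d)`. -/
def NormalProjTensor.tmul (c d : A) : NormalProjTensor P :=
  ((ContinuousLinearMap.apply ℂ ℂ d).comp (ContinuousLinearMap.apply ℂ (A →L[ℂ] ℂ) c)).comp
    (normalForms P).subtypeL

theorem NormalProjTensor.act_tmul (hP : MulSeparatelyNormal P) (a b c d : A) :
    NormalProjTensor.act hP a b (NormalProjTensor.tmul c d) =
      NormalProjTensor.tmul (a * c) (d * b) := rfl

/-- The map `f ↦ ((x, y) ↦ f (x y))` from the predual of `A` to the separately weak-star continuous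
bilinear forms. -/
def mulForm (hP : MulSeparatelyNormal P) : P →L[ℂ] normalForms P :=
  LinearMap.mkContinuous
    { toFun := fun f =>
        ⟨(ContinuousLinearMap.compL ℂ A A ℂ (f : StrongDual ℂ A)).comp
            (ContinuousLinearMap.mul ℂ A),
          fun x => (hP _ f.2 x).1, fun y => (hP _ f.2 y).2⟩
      map_add' := fun _ _ => rfl
      map_smul' := fun _ _ => rfl }
    1 (fun f => by
      refine ContinuousLinearMap.opNorm_le_bound₂ _ (by positivity) fun x y => ?_
      change ‖(f : StrongDual ℂ A) (x * y)‖ ≤ 1 * ‖f‖ * ‖x‖ * ‖y‖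
      calc ‖(f : StrongDual ℂ A) (x * y)‖ ≤ ‖(f : StrongDual ℂ A)‖ * ‖x * y‖ :=
            ContinuousLinearMap.le_opNorm _ _
        _ ≤ ‖(f : StrongDual ℂ A)‖ * (‖x‖ * ‖y‖) := by
            gcongr; exact norm_mul_le _ _
        _ = 1 * ‖f‖ * ‖x‖ * ‖y‖ := by rw [Submodule.coe_norm]; ring)

/-- The weak-star continuous extension of the multiplication of `A` to the normal projective tensor
product, i.e. the adjoint of `mulForm`. Its values are in the dual of the predual, with which a
dual algebra is identified by `toPredualDual`. -/
def NormalProjTensor.mulMap (hP : MulSeparatelyNormal P) (u : NormalProjTensor P) :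
    StrongDual ℂ P :=
  ContinuousLinearMap.comp u (mulForm hP)

/-- The canonical map `A → (A_*)^*`, `x ↦ (f ↦ f x)`. -/
def toPredualDual (x : A) : StrongDual ℂ P :=
  (ContinuousLinearMap.apply ℂ ℂ x).comp P.subtypeL

theorem NormalProjTensor.mulMap_tmul (hP : MulSeparatelyNormal P) (c d : A) :
    NormalProjTensor.mulMap hP (NormalProjTensor.tmul c d) = toPredualDual (c * d) := rfl

/-- `u` is a normal virtual diagonal of `A`: `m · u = u · m` for all `m`, and the multiplication map
sends `u` to `1`. -/
structure IsNormalVirtualDiagonal (hP : MulSeparatelyNormal P) (u : NormalProjTensor P) :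
    Prop where
  act_comm : ∀ m : A, NormalProjTensor.act hP m 1 u = NormalProjTensor.act hP 1 m u
  mulMap_eq_one : NormalProjTensor.mulMap hP u = toPredualDual (1 : A)

end Diagonal

theorem wstarPredual_mulSeparatelyNormal [CompleteSpace H] (M : Subalgebra ℂ (H →L[ℂ] H)) :
    MulSeparatelyNormal (wstarPredual M) := by
  intro f hf a
  have ha := wstar_continuous_mul_mul M a 1
  have hb := wstar_continuous_mul_mul M 1 a
  simp only [mul_one, one_mul] at ha hb
  exact ⟨@Continuous.comp _ _ _ (wstarTopology M) (wstarTopology M) _ _ (fun x : M => f x) hf ha,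
    @Continuous.comp _ _ _ (wstarTopology M) (wstarTopology M) _ _ (fun x : M => f x) hf hb⟩

/-! ### Matrices of operators, near inclusions, injectivity -/

/-- The identification of `n × n` matrices over `B(H)` with operators on `ℓ²ₙ ⊗ H`, the Hilbert
space direct sum of `n` copies of `H`: `(x v)ᵢ = ∑ⱼ xᵢⱼ vⱼ`. -/
def matrixOp (n : ℕ) : Matrix (Fin n) (Fin n) (H →L[ℂ] H) →ₗ[ℂ]
    (PiLp 2 (fun _ : Fin n => H) →L[ℂ] PiLp 2 (fun _ : Fin n => H)) where
  toFun x := ((PiLp.continuousLinearEquiv 2 ℂ (fun _ : Fin n => H)).symm :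
      (Fin n → H) →L[ℂ] PiLp 2 (fun _ : Fin n => H)).comp
    (ContinuousLinearMap.pi fun i => ∑ j, (x i j).comp (PiLp.proj 2 (fun _ : Fin n => H) j))
  map_add' x y := by
    ext v i
    simp [Finset.sum_add_distrib]
  map_smul' c x := by
    ext v i
    simp [Finset.smul_sum]

theorem matrixOp_apply (n : ℕ) (x : Matrix (Fin n) (Fin n) (H →L[ℂ] H))
    (v : PiLp 2 (fun _ : Fin n => H)) (i : Fin n) : matrixOp n x v i = ∑ j, x i j (v j) := by
  simp [matrixOp]

/-- `M_n(E)` as a subspace of `B(ℓ²ₙ ⊗ H)`. -/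
def matrixSubspace (n : ℕ) (E : Submodule ℂ (H →L[ℂ] H)) :
    Submodule ℂ (PiLp 2 (fun _ : Fin n => H) →L[ℂ] PiLp 2 (fun _ : Fin n => H)) :=
  Submodule.map (matrixOp n)
    { carrier := {x | ∀ i j, x i j ∈ E}
      add_mem' := fun hx hy i j => E.add_mem (hx i j) (hy i j)
      zero_mem' := fun _ _ => E.zero_mem
      smul_mem' := fun c _ hx i j => E.smul_mem c (hx i j) }

/-- The near inclusion `E ⊆^γ F`: every element of the unit ball of `E` is at distance at most `γ`
from some element of `F`. -/
def NearInclusion {X : Type*} [NormedAddCommGroup X] [NormedSpace ℂ X] (γ : ℝ)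
    (E F : Submodule ℂ X) : Prop :=
  ∀ x ∈ E, ‖x‖ ≤ 1 → ∃ y ∈ F, ‖x - y‖ ≤ γ

/-- The near cb-inclusion: `M_n(E) ⊆^γ M_n(F)` for all `n`. -/
def NearCBInclusion (γ : ℝ) (E F : Submodule ℂ (H →L[ℂ] H)) : Prop :=
  ∀ n : ℕ, NearInclusion γ (matrixSubspace n E) (matrixSubspace n F)

/-- A von Neumann algebra `N ⊆ B(H)` is injective if there is a completely contractive linear
projection from `B(H)` onto `N`. -/
def VonNeumannAlgebra.IsInjective [CompleteSpace H] (N : VonNeumannAlgebra H) : Prop :=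
  ∃ P : (H →L[ℂ] H) →ₗ[ℂ] (H →L[ℂ] H),
    (∀ x, P x ∈ N) ∧ (∀ y ∈ N, P y = y) ∧
    ∀ (n : ℕ) (x : Matrix (Fin n) (Fin n) (H →L[ℂ] H)), ‖matrixOp n (x.map P)‖ ≤ ‖matrixOp n x‖

end

-- The proof is a duality argument. The distance from a matrix $x$ over $M$ to $\mathbb{M}_n(N)$ is
-- controlled by finite sums of vector functionals that vanish on $\mathbb{M}_n(N)$, and regrouping
-- turns each such functional into $x\mapsto\sum_{j,k}\langle a_j,(x_{jk}\otimes 1)b_k\rangle$ with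
-- $\langle a_j,(y\otimes 1)b_k\rangle=0$ for all $y\in N$
-- (`exists_mem_matrixSubspace_norm_sub_le`). Let $p$ be the projection onto the closed span of the
-- vectors $(N\otimes 1)b_k$. It commutes with $N\otimes 1$, fixes every $b_k$ and has range
-- orthogonal to every $a_j$, so $x_{jk}\otimes 1$ may be replaced by $[x_{jk}\otimes 1,p]$. The
-- near inclusion bounds the derivation $x\mapsto[x\otimes 1,p]$ on $M$ by $2\gamma$, but only at
-- the first matrix level. The diagonal removes this restriction: averaging over $u$ gives $Z$ with
-- $[x\otimes 1,Z]=[x\otimes 1,p]$ on $M$ and $\|Z\|\le 2\gamma\|u\|$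
-- (`IsNormalRep.exists_implementing_operator`). A commutator with $Z$ has cb-norm at most
-- $2\|Z\|\le 4\|u\|\gamma$, which is the constant claimed.

universe u

noncomputable section

/-! ### Hahn–Banach extension from annihilators of sets of operators -/

section OperatorExtension

variable {K : Type u} [NormedAddCommGroup K] [InnerProductSpace ℂ K]

/-- The weighted `ℓ¹`-seminorm `v ↦ ∑ |v(ξ, η)| ‖ξ‖ ‖η‖` on finitely supported functions on pairs of
vectors. -/
def pairSeminorm (K : Type u) [NormedAddCommGroup K] [InnerProductSpace ℂ K] :
    Seminorm ℂ (K × K →₀ ℂ) :=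
  Seminorm.of (fun v => v.sum fun p c => ‖c‖ * (‖p.1‖ * ‖p.2‖))
    (fun v w => by
      classical
      rw [Finsupp.sum_of_support_subset (v + w) Finsupp.support_add _ (by simp),
        Finsupp.sum_of_support_subset v Finset.subset_union_left _ (by simp),
        Finsupp.sum_of_support_subset w Finset.subset_union_right _ (by simp),
        ← Finset.sum_add_distrib]
      refine Finset.sum_le_sum fun p _ => ?_
      rw [← add_mul, Finsupp.add_apply]
      gcongr
      exact norm_add_le _ _)
    (fun c v => by
      rw [Finsupp.sum_of_support_subset (c • v) Finsupp.support_smul _ (by simp), Finsupp.sum,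
        Finset.mul_sum]
      refine Finset.sum_congr rfl fun p _ => ?_
      rw [Finsupp.smul_apply, norm_smul, mul_assoc])

theorem pairSeminorm_apply (v : K × K →₀ ℂ) :
    pairSeminorm K v = v.sum fun p c => ‖c‖ * (‖p.1‖ * ‖p.2‖) := rfl

/-- The linear extension of `(ξ, η) ↦ ⟪ξ, T η⟫` to finitely supported functions. -/
def pairEval (T : K →L[ℂ] K) : (K × K →₀ ℂ) →ₗ[ℂ] ℂ :=
  Finsupp.linearCombination ℂ fun p : K × K => ⟪p.1, T p.2⟫_ℂ

theorem pairEval_single (T : K →L[ℂ] K) (ξ η : K) (c : ℂ) :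
    pairEval T (Finsupp.single (ξ, η) c) = c * ⟪ξ, T η⟫_ℂ := by
  simp [pairEval]

theorem pairEval_sub (S T : K →L[ℂ] K) (v : K × K →₀ ℂ) :
    pairEval (S - T) v = pairEval S v - pairEval T v := by
  simp [pairEval, Finsupp.linearCombination_apply, Finsupp.sum, mul_sub]

/-- A multiple of a vector functional is a vector functional given by two vectors of equal norm. -/
theorem exists_balanced_vectors (c : ℂ) (ξ η : K) :
    ∃ a b : K, ‖a‖ ^ 2 = ‖c‖ * (‖ξ‖ * ‖η‖) ∧ ‖b‖ ^ 2 = ‖c‖ * (‖ξ‖ * ‖η‖) ∧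
      ∀ T : K →L[ℂ] K, c * ⟪ξ, T η⟫_ℂ = ⟪a, T b⟫_ℂ := by
  set w := ‖c‖ * (‖ξ‖ * ‖η‖) with hw
  have hw0 : 0 ≤ w := by positivity
  rcases hw0.eq_or_lt with h0 | h0
  · refine ⟨0, 0, by simp [← h0], by simp [← h0], fun T => ?_⟩
    have : c = 0 ∨ ξ = 0 ∨ η = 0 := by simpa [hw] using h0.symm
    rcases this with h | h | h <;> simp [h]
  · have hs : 0 < √w := Real.sqrt_pos.2 h0
    have hξ : ‖ξ‖ ≠ 0 := fun h => by simp [hw, h] at h0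
    -- The factor on the conjugate-linear side is real, and all of $c$ goes to the right vector.
    refine ⟨((√w / ‖ξ‖ : ℝ) : ℂ) • ξ, (c * ((‖ξ‖ / √w : ℝ) : ℂ)) • η, ?_, ?_, fun T => ?_⟩
    · rw [norm_smul, Complex.norm_real, Real.norm_of_nonneg (by positivity),
        div_mul_cancel₀ _ hξ, Real.sq_sqrt hw0]
    · rw [norm_smul, norm_mul, Complex.norm_real, Real.norm_of_nonneg (by positivity)]
      have : ‖c‖ * (‖ξ‖ / √w) * ‖η‖ = w / √w := by rw [hw]; ring
      rw [this, Real.div_sqrt, Real.sq_sqrt hw0]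
    · rw [map_smul, inner_smul_left, inner_smul_right, Complex.conj_ofReal]
      have : ((√w / ‖ξ‖ : ℝ) : ℂ) * ((‖ξ‖ / √w : ℝ) : ℂ) = 1 := by
        rw [← Complex.ofReal_mul]
        field_simp
        simp
      linear_combination (-c * ⟪ξ, T η⟫_ℂ) * this

/-- Balancing each term makes $\sum\|a_i\|^2$ and $\sum\|b_i\|^2$ both equal to the seminorm of $v$,
so the product of square roots in the hypothesis is exactly that seminorm. -/
theorem norm_pairEval_le {S : Set (K →L[ℂ] K)} {X : K →L[ℂ] K} {r : ℝ}
    (h : ∀ (ι : Type u) [Fintype ι] (a b : ι → K), (∀ T ∈ S, ∑ i, ⟪a i, T (b i)⟫_ℂ = 0) →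
      ‖∑ i, ⟪a i, X (b i)⟫_ℂ‖ ≤ r * (√(∑ i, ‖a i‖ ^ 2) * √(∑ i, ‖b i‖ ^ 2)))
    (v : K × K →₀ ℂ) (hv : ∀ T ∈ S, pairEval T v = 0) :
    ‖pairEval X v‖ ≤ r * pairSeminorm K v := by
  choose a b ha hb hab using fun p : K × K => exists_balanced_vectors (v p) p.1 p.2
  have key (T : K →L[ℂ] K) : pairEval T v = ∑ i : v.support, ⟪a i, T (b i)⟫_ℂ := by
    rw [pairEval, Finsupp.linearCombination_apply, Finsupp.sum, ← Finset.sum_coe_sort]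
    exact Finset.sum_congr rfl fun p _ => by rw [smul_eq_mul, hab]
  have hp : pairSeminorm K v = ∑ i : v.support, ‖v i‖ * (‖i.1.1‖ * ‖i.1.2‖) := by
    rw [pairSeminorm_apply, Finsupp.sum, ← Finset.sum_coe_sort]
  have := h v.support (fun i => a i) (fun i => b i) fun T hT => by rw [← key, hv T hT]
  simp only [ha, hb] at this
  rwa [← key, ← hp, Real.mul_self_sqrt (apply_nonneg _ _)] at this

variable [CompleteSpace K]

/-- A bounded sesquilinear form is given by an operator. -/
theorem exists_operator_of_sesquilinear (B : K →ₗ⋆[ℂ] K →ₗ[ℂ] ℂ) {C : ℝ} (hC : 0 ≤ C)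
    (hB : ∀ ξ η, ‖B ξ η‖ ≤ C * ‖ξ‖ * ‖η‖) :
    ∃ Z : K →L[ℂ] K, ‖Z‖ ≤ C ∧ ∀ ξ η, ⟪ξ, Z η⟫_ℂ = B ξ η := by
  -- The Riesz operator of the form sits in the left slot of the inner product; its adjoint sits in
  -- the right one.
  have hZ (ξ η : K) : ⟪ξ, ContinuousLinearMap.adjoint
      (InnerProductSpace.continuousLinearMapOfBilin (B.mkContinuous₂ C hB)) η⟫_ℂ = B ξ η := by
    rw [ContinuousLinearMap.adjoint_inner_right,
      InnerProductSpace.continuousLinearMapOfBilin_apply, LinearMap.mkContinuous₂_apply]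
  refine ⟨_, ContinuousLinearMap.opNorm_le_of_re_inner_le hC fun ξ η hξ hη => ?_, hZ⟩
  have := hB η ξ
  rw [hξ, hη, mul_one, mul_one, ← hZ, ← norm_inner_symm] at this
  exact (RCLike.re_le_norm _).trans this

/-- A Hahn–Banach theorem for operators: if `X` is bounded by `r` on the vector functionals which
annihilate `S`, then it agrees on them with an operator of norm at most `r`. -/
theorem exists_norm_le_of_annihilator {S : Set (K →L[ℂ] K)} {X : K →L[ℂ] K} {r : ℝ} (hr : 0 ≤ r)
    (h : ∀ (ι : Type u) [Fintype ι] (a b : ι → K), (∀ T ∈ S, ∑ i, ⟪a i, T (b i)⟫_ℂ = 0) →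
      ‖∑ i, ⟪a i, X (b i)⟫_ℂ‖ ≤ r * (√(∑ i, ‖a i‖ ^ 2) * √(∑ i, ‖b i‖ ^ 2))) :
    ∃ Z : K →L[ℂ] K, ‖Z‖ ≤ r ∧ ∀ v : K × K →₀ ℂ, (∀ T ∈ S, pairEval T v = 0) →
      pairEval Z v = pairEval X v := by
  let W : Submodule ℂ (K × K →₀ ℂ) := ⨅ T ∈ S, LinearMap.ker (pairEval T)
  have hW (v : K × K →₀ ℂ) : v ∈ W ↔ ∀ T ∈ S, pairEval T v = 0 := by simp [W]
  have hp (v : K × K →₀ ℂ) : (r.toNNReal • pairSeminorm K) v = r * pairSeminorm K v := by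
    rw [smul_apply, NNReal.smul_def, Real.coe_toNNReal _ hr, smul_eq_mul]
  obtain ⟨g, hg, hgle⟩ := Module.Dual.exists_extension_of_le_seminorm W
    ((pairEval X).domRestrict W) (p := r.toNNReal • pairSeminorm K) fun v => by
      rw [hp]
      exact norm_pairEval_le h _ ((hW _).1 v.2)
  -- Such $v$ are the relations between vector functionals. They lie in $W$, where $g$ agrees with
  -- $X$, so $g$ kills them; sesquilinearity of $(\xi,\eta)\mapsto g(e(\xi,\eta))$ follows.
  have hgX (v : K × K →₀ ℂ) (hv : ∀ T : K →L[ℂ] K, pairEval T v = 0) : g v = 0 := by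
    have := hg ⟨v, (hW _).2 fun T _ => hv T⟩
    simpa [hv] using this
  let e (ξ η : K) : K × K →₀ ℂ := Finsupp.single (ξ, η) 1
  have he (T : K →L[ℂ] K) (ξ η : K) : pairEval T (e ξ η) = ⟪ξ, T η⟫_ℂ := by
    simp [e, pairEval_single]
  obtain ⟨Z, hZr, hZ⟩ := exists_operator_of_sesquilinear
    (LinearMap.mk₂'ₛₗ (starRingEnd ℂ) (RingHom.id ℂ) (fun ξ η => g (e ξ η))
      (fun ξ ξ' η => by
        have := hgX (e (ξ + ξ') η - (e ξ η + e ξ' η)) fun T => by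
          simp [he]
        rwa [map_sub, map_add, sub_eq_zero] at this)
      (fun c ξ η => by
        have := hgX (e (c • ξ) η - (starRingEnd ℂ c) • e ξ η) fun T => by
          simp [he, mul_comm]
        rwa [map_sub, map_smul, sub_eq_zero] at this)
      (fun ξ η η' => by
        have := hgX (e ξ (η + η') - (e ξ η + e ξ η')) fun T => by
          simp [he]
        rwa [map_sub, map_add, sub_eq_zero] at this)
      (fun c ξ η => by
        have := hgX (e ξ (c • η) - c • e ξ η) fun T => by
          simp [he]
        rwa [map_sub, map_smul, sub_eq_zero] at this)) hr
    (fun ξ η => by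
      have := hgle (e ξ η)
      rw [hp] at this
      simpa [pairSeminorm_apply, e, mul_assoc] using this)
  have hZg : pairEval Z = g := by
    refine Finsupp.lhom_ext' fun p => LinearMap.ext_ring ?_
    change pairEval Z (e p.1 p.2) = g (e p.1 p.2)
    rw [he, hZ]
    rfl
  refine ⟨Z, hZr, fun v hv => ?_⟩
  rw [hZg]
  exact hg ⟨v, (hW _).2 hv⟩

end OperatorExtension

/-! ### Ampliations and matrix norms -/

section Ampliation

theorem sum_norm_sq_flip {E ι κ : Type*} [SeminormedAddCommGroup E] [Fintype ι] [Fintype κ]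
    (c : κ → PiLp 2 (fun _ : ι => E)) :
    ∑ j, ‖c j‖ ^ 2 = ∑ i, ‖(WithLp.toLp 2 fun j => c j i : PiLp 2 (fun _ : κ => E))‖ ^ 2 := by
  simp only [PiLp.norm_sq_eq_of_L2]
  exact Finset.sum_comm

variable {H : Type u} [NormedAddCommGroup H] [InnerProductSpace ℂ H]
  (ι : Type u) [Fintype ι]

/-- The ampliation `x ⊗ 1` of an operator to a Hilbert space direct sum of copies of `H`. -/
def ampl (x : H →L[ℂ] H) : PiLp 2 (fun _ : ι => H) →L[ℂ] PiLp 2 (fun _ : ι => H) :=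
  LinearMap.mkContinuous
    { toFun := fun v => WithLp.toLp 2 fun i => x (v i)
      map_add' := fun v w => by ext i; simp
      map_smul' := fun c v => by ext i; simp } ‖x‖ (fun v => by
    refine le_of_sq_le_sq ?_ (by positivity)
    rw [mul_pow, PiLp.norm_sq_eq_of_L2, PiLp.norm_sq_eq_of_L2, Finset.mul_sum]
    refine Finset.sum_le_sum fun i _ => ?_
    rw [← mul_pow]
    gcongr
    exact x.le_opNorm _)

variable {ι}

@[simp]
theorem ampl_apply (x : H →L[ℂ] H) (v : PiLp 2 (fun _ : ι => H)) (i : ι) :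
    ampl ι x v i = x (v i) := rfl

theorem norm_ampl_le (x : H →L[ℂ] H) : ‖ampl ι x‖ ≤ ‖x‖ :=
  LinearMap.mkContinuous_norm_le _ (norm_nonneg _) _

theorem ampl_sub (x y : H →L[ℂ] H) : ampl ι (x - y) = ampl ι x - ampl ι y := by
  ext v i; simp

theorem ampl_mul (x y : H →L[ℂ] H) : ampl ι (x * y) = ampl ι x * ampl ι y := by
  ext v i; simp

variable (ι) in
/-- The ampliation as a homomorphism of algebras. -/
def amplHom : (H →L[ℂ] H) →ₐ[ℂ] (PiLp 2 (fun _ : ι => H) →L[ℂ] PiLp 2 (fun _ : ι => H)) :=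
  AlgHom.ofLinearMap
    { toFun := ampl ι
      map_add' := fun x y => by ext v i; simp
      map_smul' := fun c x => by ext v i; simp }
    (by ext v i; simp) ampl_mul

theorem inner_ampl (ξ η : PiLp 2 (fun _ : ι => H)) (x : H →L[ℂ] H) :
    ⟪ξ, ampl ι x η⟫_ℂ = ∑ i, ⟪ξ i, x (η i)⟫_ℂ := by
  rw [PiLp.inner_apply]
  rfl

theorem ampl_adjoint [CompleteSpace H] (x : H →L[ℂ] H) :
    ampl ι (ContinuousLinearMap.adjoint x) = ContinuousLinearMap.adjoint (ampl ι x) := by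
  rw [ContinuousLinearMap.eq_adjoint_iff]
  intro ξ η
  simp [PiLp.inner_apply, ContinuousLinearMap.adjoint_inner_left]

/-- Vector functionals of the ampliation are weak-star continuous. -/
theorem wstar_continuous_inner_ampl (M : Subalgebra ℂ (H →L[ℂ] H))
    (ξ η : PiLp 2 (fun _ : ι => H)) :
    Continuous[wstarTopology M, inferInstance] fun x : M => ⟪ξ, ampl ι (x : H →L[ℂ] H) η⟫_ℂ := by
  simp only [inner_ampl]
  refine @continuous_finsetSum _ _ _ (wstarTopology M) _ _ _ _ _ fun i _ => ?_
  -- Sequences supported at index $0$ exhibit a single vector functional as one of those defining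
  -- the ultraweak topology.
  have hs (v : H) : Summable fun n => ‖(Pi.single 0 v : ℕ → H) n‖ ^ 2 :=
    summable_of_ne_finset_zero (s := {0}) fun n hn => by
      rw [Pi.single_eq_of_ne (by simpa using hn)]
      simp
  have h := ultraweak_continuous_functional (hs (ξ i)) (hs (η i))
  have e : (fun T : H →L[ℂ] H => ∑' n, ⟪(Pi.single 0 (ξ i) : ℕ → H) n,
      T ((Pi.single 0 (η i) : ℕ → H) n)⟫_ℂ) = fun T => ⟪ξ i, T (η i)⟫_ℂ := by
    funext T
    rw [tsum_eq_single 0 fun n hn => by simp [Pi.single_eq_of_ne hn]]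
    simp
  rw [e] at h
  exact @Continuous.comp _ _ _ (wstarTopology M) (ultraweakTopology H) _ _ _ h
    continuous_induced_dom

/-- One array of vectors of $H$ is read in two ways: as `ι` many vectors of $\ell^2_n\otimes H$, or
as $n$ vectors in a direct sum of copies of $H$. -/
theorem sum_inner_matrixOp {n : ℕ} (x : Matrix (Fin n) (Fin n) (H →L[ℂ] H))
    (a b : Fin n → PiLp 2 (fun _ : ι => H)) :
    ∑ i, ⟪(WithLp.toLp 2 fun j => a j i : PiLp 2 (fun _ : Fin n => H)),
        matrixOp n x (WithLp.toLp 2 fun j => b j i)⟫_ℂ =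
      ∑ j, ∑ k, ⟪a j, ampl ι (x j k) (b k)⟫_ℂ := by
  simp only [inner_ampl]
  simp only [PiLp.inner_apply, matrixOp_apply, inner_sum]
  rw [Finset.sum_comm (s := (Finset.univ : Finset ι))]
  exact Finset.sum_congr rfl fun j _ => Finset.sum_comm

/-- The bound of `∑ ⟪aⱼ, (xⱼₖ ⊗ 1) bₖ⟫` by the norm of the matrix `x`. -/
theorem norm_sum_inner_ampl_le {n : ℕ} (x : Matrix (Fin n) (Fin n) (H →L[ℂ] H))
    (a b : Fin n → PiLp 2 (fun _ : ι => H)) :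
    ‖∑ j, ∑ k, ⟪a j, ampl ι (x j k) (b k)⟫_ℂ‖ ≤
      ‖matrixOp n x‖ * (√(∑ j, ‖a j‖ ^ 2) * √(∑ k, ‖b k‖ ^ 2)) := by
  rw [← sum_inner_matrixOp, sum_norm_sq_flip a, sum_norm_sq_flip b]
  refine le_trans ?_ (mul_le_mul_of_nonneg_left (Real.sum_mul_le_sqrt_mul_sqrt _ _ _)
    (norm_nonneg _))
  rw [Finset.mul_sum]
  refine (norm_sum_le _ _).trans (Finset.sum_le_sum fun i _ => ?_)
  refine (norm_inner_le_norm _ _).trans ?_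
  rw [mul_left_comm]
  gcongr
  exact ContinuousLinearMap.le_opNorm _ _

/-- In one term $Z$ is absorbed into the $b_k$, in the other $Z^*$ into the $a_j$. Each costs a
factor $\|Z\|$ independent of $n$; this is where complete boundedness enters. -/
theorem norm_sum_inner_commutator_le [CompleteSpace H] {n : ℕ}
    (x : Matrix (Fin n) (Fin n) (H →L[ℂ] H)) (a b : Fin n → PiLp 2 (fun _ : ι => H))
    (Z : PiLp 2 (fun _ : ι => H) →L[ℂ] PiLp 2 (fun _ : ι => H)) :
    ‖∑ j, ∑ k, ⟪a j, (ampl ι (x j k) * Z - Z * ampl ι (x j k)) (b k)⟫_ℂ‖ ≤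
      2 * ‖Z‖ * ‖matrixOp n x‖ * (√(∑ j, ‖a j‖ ^ 2) * √(∑ k, ‖b k‖ ^ 2)) := by
  have hZ (T : PiLp 2 (fun _ : ι => H) →L[ℂ] PiLp 2 (fun _ : ι => H)) (hT : ‖T‖ ≤ ‖Z‖)
      (c : Fin n → PiLp 2 (fun _ : ι => H)) :
      √(∑ j, ‖T (c j)‖ ^ 2) ≤ ‖Z‖ * √(∑ j, ‖c j‖ ^ 2) := by
    rw [← Real.sqrt_sq (norm_nonneg Z), ← Real.sqrt_mul (sq_nonneg _), Finset.mul_sum]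
    refine Real.sqrt_le_sqrt (Finset.sum_le_sum fun j _ => ?_)
    rw [← mul_pow]
    gcongr
    exact (T.le_opNorm _).trans (by gcongr)
  have h1 := norm_sum_inner_ampl_le x a fun k => Z (b k)
  have h2 := norm_sum_inner_ampl_le x (fun j => ContinuousLinearMap.adjoint Z (a j)) b
  have hb := hZ Z le_rfl b
  have ha := hZ (ContinuousLinearMap.adjoint Z) (by simp) a
  have e : ∑ j, ∑ k, ⟪a j, (ampl ι (x j k) * Z - Z * ampl ι (x j k)) (b k)⟫_ℂ =
      ∑ j, ∑ k, ⟪a j, ampl ι (x j k) (Z (b k))⟫_ℂ -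
        ∑ j, ∑ k, ⟪ContinuousLinearMap.adjoint Z (a j), ampl ι (x j k) (b k)⟫_ℂ := by
    simp only [← Finset.sum_sub_distrib, ContinuousLinearMap.adjoint_inner_left, ← inner_sub_right]
    rfl
  rw [e]
  refine (norm_sub_le _ _).trans ((add_le_add h1 h2).trans ?_)
  calc _ ≤ ‖matrixOp n x‖ * (√(∑ j, ‖a j‖ ^ 2) * (‖Z‖ * √(∑ k, ‖b k‖ ^ 2))) +
        ‖matrixOp n x‖ * ((‖Z‖ * √(∑ j, ‖a j‖ ^ 2)) * √(∑ k, ‖b k‖ ^ 2)) := by gcongr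
    _ = _ := by ring

end Ampliation

/-! ### Derivations implemented by a normal virtual diagonal -/

section VirtualDiagonal

variable {A : Type u} [NormedRing A] [NormedAlgebra ℂ A] {P : Submodule ℂ (StrongDual ℂ A)}
  {L : Type u} [NormedAddCommGroup L] [InnerProductSpace ℂ L]

/-- A contractive representation is normal with respect to the predual `P` if all its vector
functionals are in `P`. -/
structure IsNormalRep (P : Submodule ℂ (StrongDual ℂ A)) (π : A →ₐ[ℂ] (L →L[ℂ] L)) : Prop where
  norm_le : ∀ a, ‖π a‖ ≤ ‖a‖
  mem_of_eq_inner : ∀ (ξ η : L) (f : StrongDual ℂ A), (∀ a, f a = ⟪ξ, π a η⟫_ℂ) → f ∈ P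

variable {π : A →ₐ[ℂ] (L →L[ℂ] L)}

/-- The vector functional `x ↦ ⟪ξ, π x η⟫`. -/
def IsNormalRep.functional (hπ : IsNormalRep P π) (ξ η : L) : P :=
  ⟨LinearMap.mkContinuous
    { toFun := fun c => ⟪ξ, π c η⟫_ℂ
      map_add' := fun c d => by simp
      map_smul' := fun r c => by simp } (‖ξ‖ * ‖η‖)
    (fun c => by
      change ‖⟪ξ, π c η⟫_ℂ‖ ≤ _
      refine (norm_inner_le_norm _ _).trans ?_
      rw [mul_assoc, mul_comm ‖η‖]
      exact mul_le_mul_of_nonneg_left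
        (ContinuousLinearMap.le_of_opNorm_le _ (hπ.norm_le c) _) (norm_nonneg _)),
    hπ.mem_of_eq_inner ξ η _ fun _ => rfl⟩

theorem IsNormalRep.norm_inner_commutator_le (hπ : IsNormalRep P π) {p : L →L[ℂ] L}
    {C : ℝ} (hp : ∀ x, ‖π x * p - p * π x‖ ≤ C * ‖x‖) (ξ η : L) (c d : A) :
    ‖⟪ξ, π c ((π d * p - p * π d) η)⟫_ℂ‖ ≤ C * ‖ξ‖ * ‖η‖ * ‖c‖ * ‖d‖ := by
  calc _ ≤ ‖ξ‖ * (‖c‖ * ((C * ‖d‖) * ‖η‖)) := by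
        refine (norm_inner_le_norm _ _).trans ?_
        gcongr
        refine (ContinuousLinearMap.le_opNorm _ _).trans ?_
        gcongr
        · exact hπ.norm_le c
        · exact ContinuousLinearMap.le_of_opNorm_le _ (hp d) _
    _ = _ := by ring

variable [CompleteSpace L]

/-- The form `(c, d) ↦ ⟪ξ, π c [π d, p] η⟫`. -/
def IsNormalRep.commutatorForm (hπ : IsNormalRep P π) (p : L →L[ℂ] L) {C : ℝ}
    (hp : ∀ x, ‖π x * p - p * π x‖ ≤ C * ‖x‖) (ξ η : L) : normalForms P :=
  ⟨LinearMap.mkContinuous₂ (LinearMap.mk₂ ℂ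
      (fun c d => ⟪ξ, π c ((π d * p - p * π d) η)⟫_ℂ)
      (fun c c' d => by simp)
      (fun r c d => by simp)
      (fun c d d' => by
        rw [← inner_add_right, ← map_add (π c), ← add_apply, map_add, add_mul, mul_add,
          add_sub_add_comm])
      (fun r c d => by
        rw [smul_eq_mul, ← inner_smul_right, ← map_smul (π c), ← smul_apply, map_smul,
          smul_mul_assoc, mul_smul_comm, smul_sub]))
      (C * ‖ξ‖ * ‖η‖) (hπ.norm_inner_commutator_le hp ξ η),
    fun c => by
      -- As a function of $d$ the form is a difference of two vector functionals, once $\pi(c)$ and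
      -- $p$ are moved to the left vector by adjoints.
      have := P.sub_mem
        (hπ.functional (ContinuousLinearMap.adjoint (π c) ξ) (p η)).2
        (hπ.functional (ContinuousLinearMap.adjoint p (ContinuousLinearMap.adjoint (π c) ξ)) η).2
      convert! this using 1
      ext d
      change ⟪ξ, π c ((π d * p - p * π d) η)⟫_ℂ =
        ⟪ContinuousLinearMap.adjoint (π c) ξ, π d (p η)⟫_ℂ -
          ⟪ContinuousLinearMap.adjoint p (ContinuousLinearMap.adjoint (π c) ξ), π d η⟫_ℂ
      simp [ContinuousLinearMap.adjoint_inner_left],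
    fun d => hπ.mem_of_eq_inner ξ ((π d * p - p * π d) η) _ fun _ => rfl⟩

variable {p : L →L[ℂ] L} {C : ℝ}

theorem IsNormalRep.commutatorForm_apply (hπ : IsNormalRep P π)
    (hp : ∀ x, ‖π x * p - p * π x‖ ≤ C * ‖x‖) (ξ η : L) (c d : A) :
    (hπ.commutatorForm p hp ξ η : A →L[ℂ] A →L[ℂ] ℂ) c d =
      ⟪ξ, π c ((π d * p - p * π d) η)⟫_ℂ := rfl

theorem IsNormalRep.norm_commutatorForm_le (hπ : IsNormalRep P π) (hC : 0 ≤ C)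
    (hp : ∀ x, ‖π x * p - p * π x‖ ≤ C * ‖x‖) (ξ η : L) :
    ‖hπ.commutatorForm p hp ξ η‖ ≤ C * ‖ξ‖ * ‖η‖ :=
  ContinuousLinearMap.opNorm_le_bound₂ _ (by positivity) (hπ.norm_inner_commutator_le hp ξ η)

theorem normalForms_ext {ψ φ : normalForms P}
    (h : ∀ c d : A, (ψ : A →L[ℂ] A →L[ℂ] ℂ) c d = (φ : A →L[ℂ] A →L[ℂ] ℂ) c d) : ψ = φ :=
  Subtype.ext (ContinuousLinearMap.ext fun c => ContinuousLinearMap.ext fun d => h c d)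

/-- `IsNormalRep.commutatorForm` as a sesquilinear map. -/
def IsNormalRep.commutatorFormₗ (hπ : IsNormalRep P π) (p : L →L[ℂ] L) {C : ℝ}
    (hp : ∀ x, ‖π x * p - p * π x‖ ≤ C * ‖x‖) : L →ₗ⋆[ℂ] L →ₗ[ℂ] normalForms P :=
  LinearMap.mk₂'ₛₗ (starRingEnd ℂ) (RingHom.id ℂ) (hπ.commutatorForm p hp)
    (fun ξ ξ' η => normalForms_ext fun c d => by
      simp only [commutatorForm_apply, Submodule.coe_add, add_apply, inner_add_left])
    (fun r ξ η => normalForms_ext fun c d => by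
      simp only [commutatorForm_apply, Submodule.coe_smul, smul_apply, smul_eq_mul,
        inner_smul_left])
    (fun ξ η η' => normalForms_ext fun c d => by
      simp only [commutatorForm_apply, Submodule.coe_add, add_apply, map_add, inner_add_right])
    (fun r ξ η => normalForms_ext fun c d => by
      simp only [commutatorForm_apply, Submodule.coe_smul, smul_apply, smul_eq_mul, map_smul,
        inner_smul_right, RingHom.id_apply])

theorem IsNormalRep.act_left_commutatorForm (hP : MulSeparatelyNormal P) (hπ : IsNormalRep P π)
    (hp : ∀ x, ‖π x * p - p * π x‖ ≤ C * ‖x‖) (m : A) (ξ η : L) :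
    normalForms.act hP m 1 (hπ.commutatorForm p hp ξ η) =
      hπ.commutatorForm p hp (ContinuousLinearMap.adjoint (π m) ξ) η :=
  normalForms_ext fun c d => by
    rw [normalForms.act_apply, commutatorForm_apply, commutatorForm_apply,
      ContinuousLinearMap.adjoint_inner_left, mul_one, map_mul]
    rfl

/-- This is the Leibniz rule $[\pi(dm),p]=[\pi(d),p]\pi(m)+\pi(d)[\pi(m),p]$. The last term,
multiplied by $\pi(c)$, depends only on the product $cd$, so $u$ evaluates it through the
multiplication map. -/
theorem IsNormalRep.act_right_commutatorForm (hP : MulSeparatelyNormal P) (hπ : IsNormalRep P π)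
    (hp : ∀ x, ‖π x * p - p * π x‖ ≤ C * ‖x‖) (m : A) (ξ η : L) :
    normalForms.act hP 1 m (hπ.commutatorForm p hp ξ η) =
      hπ.commutatorForm p hp ξ (π m η) +
        mulForm hP (hπ.functional ξ ((π m * p - p * π m) η)) :=
  normalForms_ext fun c d => by
    rw [normalForms.act_apply, Submodule.coe_add, add_apply, add_apply]
    change _ = _ + ⟪ξ, π (c * d) _⟫_ℂ
    rw [commutatorForm_apply, commutatorForm_apply, one_mul, ← inner_add_right, map_mul π c d,
      mul_apply_eq_comp, ← map_add, map_mul π d m]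
    congr 2
    simp only [mul_apply_eq_comp, sub_apply, map_sub]
    abel

/-- If `A` has a normal virtual diagonal `u`, then a derivation `x ↦ [π x, p]` on `A` which is
bounded by `C` is implemented by an operator of norm at most `‖u‖ C`. -/
theorem IsNormalRep.exists_implementing_operator {hP : MulSeparatelyNormal P}
    {u : NormalProjTensor P} (hu : IsNormalVirtualDiagonal hP u) (hπ : IsNormalRep P π)
    (hC : 0 ≤ C) (hp : ∀ x, ‖π x * p - p * π x‖ ≤ C * ‖x‖) :
    ∃ Z : L →L[ℂ] L, ‖Z‖ ≤ ‖u‖ * C ∧ ∀ x, π x * Z - Z * π x = π x * p - p * π x := by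
  -- For $u=\sum c_i\otimes d_i$ this would be $Z=\sum\pi(c_i)[\pi(d_i),p]$; for general $u$ it is
  -- defined weakly.
  obtain ⟨Z, hZn, hZ⟩ := exists_operator_of_sesquilinear
    ((hπ.commutatorFormₗ p hp).compr₂ₛₗ (u : normalForms P →ₗ[ℂ] ℂ))
    (C := ‖u‖ * C) (by positivity) (fun ξ η => by
      rw [mul_assoc, mul_assoc, ← mul_assoc C]
      exact ContinuousLinearMap.le_opNorm_of_le u (hπ.norm_commutatorForm_le hC hp ξ η))
  replace hZ (ξ η : L) : ⟪ξ, Z η⟫_ℂ = u (hπ.commutatorForm p hp ξ η) := hZ ξ η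
  refine ⟨Z, hZn, fun m => ContinuousLinearMap.ext fun η => ext_inner_left ℂ fun ξ => ?_⟩
  set δ := π m * p - p * π m with hδ
  have hcomm : u (normalForms.act hP m 1 (hπ.commutatorForm p hp ξ η)) =
      u (normalForms.act hP 1 m (hπ.commutatorForm p hp ξ η)) :=
    DFunLike.congr_fun (hu.act_comm m) (hπ.commutatorForm p hp ξ η)
  have hone : u (mulForm hP (hπ.functional ξ (δ η))) = ⟪ξ, π 1 (δ η)⟫_ℂ :=
    DFunLike.congr_fun hu.mulMap_eq_one (hπ.functional ξ (δ η))
  -- The identity $m\cdot u=u\cdot m$ becomes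
  -- $\langle\xi,\pi(m)Z\eta\rangle=\langle\xi,Z\pi(m)\eta\rangle+\langle\xi,\delta\eta\rangle$, the
  -- last term coming from $m_\sigma(u)=1$.
  rw [act_left_commutatorForm, act_right_commutatorForm, map_add u, hone, ← hZ, ← hZ,
    ContinuousLinearMap.adjoint_inner_left, map_one] at hcomm
  rw [sub_apply, inner_sub_right]
  exact sub_eq_of_eq_add' hcomm

end VirtualDiagonal

/-! ### Distance to matrices over a von Neumann algebra -/

section Distance

variable {H : Type u} [NormedAddCommGroup H] [InnerProductSpace ℂ H]

/-- The matrix entries of an operator on `ℓ²ₙ ⊗ H`. -/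
def matrixEntry {n : ℕ} (T : PiLp 2 (fun _ : Fin n => H) →L[ℂ] PiLp 2 (fun _ : Fin n => H)) :
    Matrix (Fin n) (Fin n) (H →L[ℂ] H) :=
  fun i j => (PiLp.proj 2 (fun _ : Fin n => H) i).comp (T.comp
    ((PiLp.continuousLinearEquiv 2 ℂ (fun _ : Fin n => H)).symm.toContinuousLinearMap.comp
      (ContinuousLinearMap.single ℂ (fun _ : Fin n => H) j)))

theorem matrixEntry_apply {n : ℕ}
    (T : PiLp 2 (fun _ : Fin n => H) →L[ℂ] PiLp 2 (fun _ : Fin n => H)) (i j : Fin n) (η : H) :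
    matrixEntry T i j η = T (PiLp.single 2 j η) i := rfl

theorem matrixOp_matrixEntry {n : ℕ}
    (T : PiLp 2 (fun _ : Fin n => H) →L[ℂ] PiLp 2 (fun _ : Fin n => H)) :
    matrixOp n (matrixEntry T) = T := by
  ext v i
  rw [matrixOp_apply]
  simp only [matrixEntry_apply]
  have : v = ∑ j, PiLp.single 2 j (v j) := by
    ext k
    simp [Pi.single_apply]
  conv_rhs => rw [this, map_sum]
  simp

theorem matrixEntry_matrixOp {n : ℕ} (x : Matrix (Fin n) (Fin n) (H →L[ℂ] H)) :
    matrixEntry (matrixOp n x) = x := by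
  ext i j η
  rw [matrixEntry_apply, matrixOp_apply, Finset.sum_eq_single j] <;> simp +contextual

theorem inner_single_apply {n : ℕ}
    (T : PiLp 2 (fun _ : Fin n => H) →L[ℂ] PiLp 2 (fun _ : Fin n => H)) (i j : Fin n) (ξ η : H) :
    ⟪(PiLp.single 2 i ξ : PiLp 2 (fun _ : Fin n => H)), T (PiLp.single 2 j η)⟫_ℂ =
      ⟪ξ, matrixEntry T i j η⟫_ℂ := by
  rw [PiLp.inner_apply, Finset.sum_eq_single i]
  · simp [matrixEntry_apply]
  · intro k _ hk
    simp [hk]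
  · simp

theorem mem_matrixSubspace_iff {n : ℕ} {E : Submodule ℂ (H →L[ℂ] H)}
    {T : PiLp 2 (fun _ : Fin n => H) →L[ℂ] PiLp 2 (fun _ : Fin n => H)} :
    T ∈ matrixSubspace n E ↔ ∀ i j, matrixEntry T i j ∈ E := by
  constructor
  · rintro ⟨x, hx, rfl⟩
    rw [matrixEntry_matrixOp]
    exact hx
  · exact fun h => ⟨matrixEntry T, h, matrixOp_matrixEntry T⟩

/-- A functional annihilating the matrices over `N` annihilates `N` entrywise. -/
theorem inner_ampl_eq_zero_of_annihilator {E : Submodule ℂ (H →L[ℂ] H)} {ι : Type u} [Fintype ι]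
    {n : ℕ} {a b : Fin n → PiLp 2 (fun _ : ι => H)}
    (h : ∀ z : Matrix (Fin n) (Fin n) (H →L[ℂ] H), (∀ j k, z j k ∈ E) →
      ∑ j, ∑ k, ⟪a j, ampl ι (z j k) (b k)⟫_ℂ = 0)
    (j k : Fin n) {y : H →L[ℂ] H} (hy : y ∈ E) : ⟪a j, ampl ι y (b k)⟫_ℂ = 0 := by
  have h0 : ampl ι (0 : H →L[ℂ] H) = 0 := map_zero (amplHom ι)
  -- The matrix with the single nonzero entry $y$ isolates one summand.
  have := h (Matrix.single j k y) fun i l => by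
    rw [Matrix.single_apply]
    split_ifs
    exacts [hy, E.zero_mem]
  rw [Finset.sum_eq_single j, Finset.sum_eq_single k, Matrix.single_apply_same] at this
  · exact this
  · intro l _ hl
    rw [Matrix.single_apply_of_col_ne _ _ hl.symm, h0, zero_apply, inner_zero_right]
  · simp
  · intro l _ hl
    refine Finset.sum_eq_zero fun m _ => ?_
    rw [Matrix.single_apply_of_row_ne hl.symm, h0, zero_apply, inner_zero_right]
  · simp

variable [CompleteSpace H]

/-- Matrices over a von Neumann algebra are determined by the vector functionals annihilating
them. -/
theorem mem_matrixSubspace_of_annihilator (N : VonNeumannAlgebra H) {n : ℕ}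
    {T : PiLp 2 (fun _ : Fin n => H) →L[ℂ] PiLp 2 (fun _ : Fin n => H)}
    (hT : ∀ v : PiLp 2 (fun _ : Fin n => H) × PiLp 2 (fun _ : Fin n => H) →₀ ℂ,
      (∀ S ∈ matrixSubspace n (Subalgebra.toSubmodule N.toStarSubalgebra.toSubalgebra),
        pairEval S v = 0) → pairEval T v = 0) :
    T ∈ matrixSubspace n (Subalgebra.toSubmodule N.toStarSubalgebra.toSubalgebra) := by
  refine mem_matrixSubspace_iff.2 fun i j => ?_
  change matrixEntry T i j ∈ N
  rw [← N.commutant_commutant, VonNeumannAlgebra.mem_commutant_iff]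
  intro g hg
  rw [VonNeumannAlgebra.mem_commutant_iff] at hg
  refine ContinuousLinearMap.ext fun η => ext_inner_left ℂ fun ξ => ?_
  -- This $v$ evaluates an operator $S$ to $\langle\xi,[g,S_{ij}]\eta\rangle$. It vanishes on
  -- matrices over $N$ since $g\in N'$, and its vanishing at $T$ for all such $g$ puts $T_{ij}$ in
  -- $N''=N$.
  let v : PiLp 2 (fun _ : Fin n => H) × PiLp 2 (fun _ : Fin n => H) →₀ ℂ :=
    Finsupp.single (PiLp.single 2 i (ContinuousLinearMap.adjoint g ξ), PiLp.single 2 j η) 1 -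
      Finsupp.single (PiLp.single 2 i ξ, PiLp.single 2 j (g η)) 1
  have hv (S : PiLp 2 (fun _ : Fin n => H) →L[ℂ] PiLp 2 (fun _ : Fin n => H)) :
      pairEval S v = ⟪ξ, (g * matrixEntry S i j) η⟫_ℂ - ⟪ξ, (matrixEntry S i j * g) η⟫_ℂ := by
    rw [map_sub, pairEval_single, pairEval_single, one_mul, one_mul, inner_single_apply,
      inner_single_apply, ContinuousLinearMap.adjoint_inner_left]
    rfl
  have := hT v fun S hS => by
    rw [hv, hg _ (mem_matrixSubspace_iff.1 hS i j), sub_self]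
  rwa [hv, sub_eq_zero] at this

/-- The distance of a matrix to the matrices over a von Neumann algebra `N` is at most `r` if `r`
bounds it on the functionals annihilating `N` entrywise. -/
theorem exists_mem_matrixSubspace_norm_sub_le (N : VonNeumannAlgebra H) {n : ℕ}
    {x : Matrix (Fin n) (Fin n) (H →L[ℂ] H)} {r : ℝ} (hr : 0 ≤ r)
    (h : ∀ (ι : Type u) [Fintype ι] (a b : Fin n → PiLp 2 (fun _ : ι => H)),
      (∀ j k, ∀ y ∈ N, ⟪a j, ampl ι y (b k)⟫_ℂ = 0) →
      ‖∑ j, ∑ k, ⟪a j, ampl ι (x j k) (b k)⟫_ℂ‖ ≤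
        r * (√(∑ j, ‖a j‖ ^ 2) * √(∑ k, ‖b k‖ ^ 2))) :
    ∃ y ∈ matrixSubspace n (Subalgebra.toSubmodule N.toStarSubalgebra.toSubalgebra),
      ‖matrixOp n x - y‖ ≤ r := by
  obtain ⟨Z, hZ, hZX⟩ := exists_norm_le_of_annihilator
    (S := (matrixSubspace n (Subalgebra.toSubmodule N.toStarSubalgebra.toSubalgebra) : Set _))
    (X := matrixOp n x) hr fun ι _ a b hab => by
      have he (z : Matrix (Fin n) (Fin n) (H →L[ℂ] H)) := sum_inner_matrixOp z
        (fun j => (WithLp.toLp 2 fun i => a i j : PiLp 2 (fun _ : ι => H)))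
        (fun j => (WithLp.toLp 2 fun i => b i j : PiLp 2 (fun _ : ι => H)))
      have hann := inner_ampl_eq_zero_of_annihilator fun z hz =>
        (he z).symm.trans (hab _ ⟨z, hz, rfl⟩)
      have hle := h ι _ _ fun j k y hy => hann j k hy
      rw [← he] at hle
      rw [sum_norm_sq_flip a, sum_norm_sq_flip b]
      exact hle
  -- $Z$ and the matrix agree on the annihilator of $\mathbb{M}_n(N)$, so their difference lies in
  -- $\mathbb{M}_n(N)$, at distance $\|Z\|\le r$.
  refine ⟨matrixOp n x - Z, mem_matrixSubspace_of_annihilator N fun v hv => ?_, by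
    rwa [sub_sub_cancel]⟩
  rw [pairEval_sub, hZX v hv, sub_self]

/-- The projection onto the closed `N`-invariant subspace generated by the vectors `bₖ`. -/
theorem exists_projection_of_annihilator (N : VonNeumannAlgebra H) {ι : Type u} [Fintype ι] {n : ℕ}
    {a b : Fin n → PiLp 2 (fun _ : ι => H)}
    (h : ∀ j k, ∀ y ∈ N, ⟪a j, ampl ι y (b k)⟫_ℂ = 0) :
    ∃ p : PiLp 2 (fun _ : ι => H) →L[ℂ] PiLp 2 (fun _ : ι => H), ‖p‖ ≤ 1 ∧
      (∀ y ∈ N, ampl ι y * p = p * ampl ι y) ∧ (∀ k, p (b k) = b k) ∧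
      ∀ j v, ⟪a j, p v⟫_ℂ = 0 := by
  let W₀ : Submodule ℂ (PiLp 2 (fun _ : ι => H)) :=
    Submodule.span ℂ {w | ∃ y ∈ N, ∃ k, ampl ι y (b k) = w}
  let W := W₀.topologicalClosure
  have hW₀ (w) (hw : w ∈ W₀) : w ∈ W := W₀.le_topologicalClosure hw
  have : CompleteSpace W := W₀.isClosed_topologicalClosure.completeSpace_coe
  have hinv (y) (hy : y ∈ N) (w) (hw : w ∈ W) : ampl ι y w ∈ W := by
    refine map_mem_closure (ampl ι y).continuous hw fun w hw => ?_
    induction hw using Submodule.span_induction with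
    | mem w hw =>
      obtain ⟨z, hz, k, rfl⟩ := hw
      exact Submodule.subset_span ⟨y * z, mul_mem hy hz, k, by rw [ampl_mul]; rfl⟩
    | zero => rw [map_zero]; exact W₀.zero_mem
    | add w w' _ _ hw hw' => rw [map_add]; exact W₀.add_mem hw hw'
    | smul c w _ hw => rw [map_smul]; exact W₀.smul_mem c hw
  -- Since $N$ is self-adjoint, the complement of $W$ is invariant too, which makes the projection
  -- commute with $N\otimes 1$.
  have horth (y) (hy : y ∈ N) (w) (hw : w ∈ Wᗮ) : ampl ι y w ∈ Wᗮ := by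
    rw [Submodule.mem_orthogonal] at hw ⊢
    intro v hv
    have := hw _ (hinv (star y) (star_mem hy) v hv)
    rwa [ContinuousLinearMap.star_eq_adjoint, ampl_adjoint,
      ContinuousLinearMap.adjoint_inner_left] at this
  refine ⟨W.starProjection, W.starProjection_norm_le, fun y hy => ?_, fun k => ?_, fun j v => ?_⟩
  · ext1 v
    exact (Submodule.eq_starProjection_of_mem_orthogonal'
      (hinv y hy _ (W.starProjection_apply_mem v))
      (horth y hy _ (Submodule.sub_starProjection_mem_orthogonal v))
      (by rw [← map_add, add_sub_cancel]; rfl)).symm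
  · refine Submodule.starProjection_eq_self_iff.2
      (hW₀ _ (Submodule.subset_span ⟨1, one_mem N, k, ?_⟩))
    exact congrArg (fun T : PiLp 2 (fun _ : ι => H) →L[ℂ] PiLp 2 (fun _ : ι => H) => T (b k))
      (map_one (amplHom ι))
  · have hle : W ≤ (ℂ ∙ a j)ᗮ := by
      refine Submodule.topologicalClosure_minimal _ (Submodule.span_le.2 ?_)
        (Submodule.isClosed_orthogonal _)
      rintro _ ⟨y, hy, k, rfl⟩
      exact Submodule.mem_orthogonal_singleton_iff_inner_right.2 (h j k y hy)
    exact Submodule.mem_orthogonal_singleton_iff_inner_right.1 (hle (W.starProjection_apply_mem v))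

/-- Only finitely many copies of $H$ occur, so vector functionals of the ampliation are finite sums
of weak-star continuous ones. This allows $u$ to act on derivations of the ampliation. -/
theorem isNormalRep_ampl (M : Subalgebra ℂ (H →L[ℂ] H)) (ι : Type u) [Fintype ι] :
    IsNormalRep (wstarPredual M) ((amplHom ι).comp M.val) where
  norm_le a := norm_ampl_le (a : H →L[ℂ] H)
  mem_of_eq_inner ξ η f hf := by
    change Continuous[wstarTopology M, inferInstance] fun x : M => f x
    rw [show (fun x : M => f x) = _ from funext hf]
    exact wstar_continuous_inner_ampl M ξ η

/-- If `M` has a normal virtual diagonal `u`, then a derivation `x ↦ [x ⊗ 1, p]` on `M` which is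
bounded by `C` is implemented by an operator of norm at most `‖u‖ C`. -/
theorem exists_implementing_operator_ampl {M : Subalgebra ℂ (H →L[ℂ] H)}
    {u : NormalProjTensor (wstarPredual M)}
    (hu : IsNormalVirtualDiagonal (wstarPredual_mulSeparatelyNormal M) u) {ι : Type u} [Fintype ι]
    {p : PiLp 2 (fun _ : ι => H) →L[ℂ] PiLp 2 (fun _ : ι => H)} {C : ℝ} (hC : 0 ≤ C)
    (hp : ∀ x ∈ M, ‖ampl ι x * p - p * ampl ι x‖ ≤ C * ‖x‖) :
    ∃ Z : PiLp 2 (fun _ : ι => H) →L[ℂ] PiLp 2 (fun _ : ι => H), ‖Z‖ ≤ ‖u‖ * C ∧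
      ∀ x ∈ M, ampl ι x * Z - Z * ampl ι x = ampl ι x * p - p * ampl ι x := by
  obtain ⟨Z, hZ, hZc⟩ := (isNormalRep_ampl M ι).exists_implementing_operator hu (p := p) hC
    fun y => hp y y.2
  exact ⟨Z, hZ, fun x hx => hZc ⟨x, hx⟩⟩

/-- If `M` is nearly included in `N`, then the elements of `M` nearly commute with the contractions
which commute with `N`. -/
theorem norm_commutator_le_of_nearInclusion {M : Subalgebra ℂ (H →L[ℂ] H)}
    {N : VonNeumannAlgebra H} {γ : ℝ}
    (h : NearInclusion γ (Subalgebra.toSubmodule M)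
      (Subalgebra.toSubmodule N.toStarSubalgebra.toSubalgebra)) {ι : Type u} [Fintype ι]
    {p : PiLp 2 (fun _ : ι => H) →L[ℂ] PiLp 2 (fun _ : ι => H)} (hp : ‖p‖ ≤ 1)
    (hpN : ∀ y ∈ N, ampl ι y * p = p * ampl ι y) {x : H →L[ℂ] H} (hx : x ∈ M) :
    ‖ampl ι x * p - p * ampl ι x‖ ≤ 2 * γ * ‖x‖ := by
  obtain ⟨y, hy, hxy⟩ : ∃ y ∈ N, ‖x - y‖ ≤ γ * ‖x‖ := by
    rcases eq_or_ne x 0 with rfl | hx0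
    · exact ⟨0, zero_mem N, by simp⟩
    have hn : (‖x‖ : ℂ) ≠ 0 := by exact_mod_cast norm_ne_zero_iff.2 hx0
    obtain ⟨y, hy, hxy⟩ := h ((‖x‖ : ℂ)⁻¹ • x) (M.smul_mem hx _) (by
      rw [norm_smul, norm_inv, Complex.norm_real, norm_norm,
        inv_mul_cancel₀ (norm_ne_zero_iff.2 hx0)])
    refine ⟨(‖x‖ : ℂ) • y, N.toStarSubalgebra.toSubalgebra.smul_mem hy _, ?_⟩
    calc ‖x - (‖x‖ : ℂ) • y‖ = ‖(‖x‖ : ℂ) • ((‖x‖ : ℂ)⁻¹ • x - y)‖ := by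
          rw [smul_sub, smul_inv_smul₀ hn]
      _ ≤ γ * ‖x‖ := by
          rw [norm_smul, Complex.norm_real, norm_norm, mul_comm]
          gcongr
  -- As $p$ commutes with $y\otimes 1$, only $x-y$ contributes; the two terms of the commutator give
  -- the factor $2$.
  have e : ampl ι x * p - p * ampl ι x = ampl ι (x - y) * p - p * ampl ι (x - y) := by
    rw [ampl_sub, sub_mul, mul_sub, hpN y hy]
    abel
  have hb := norm_ampl_le (ι := ι) (x - y)
  calc ‖ampl ι x * p - p * ampl ι x‖
      ≤ ‖ampl ι (x - y)‖ * ‖p‖ + ‖p‖ * ‖ampl ι (x - y)‖ := by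
        rw [e]
        exact (norm_sub_le _ _).trans (add_le_add (norm_mul_le _ _) (norm_mul_le _ _))
    _ ≤ ‖x - y‖ * 1 + 1 * ‖x - y‖ := by gcongr
    _ ≤ 2 * γ * ‖x‖ := by linarith

/-- The estimate of functionals annihilating the matrices over `N` at matrices over `M`. -/
theorem norm_sum_inner_ampl_le_of_annihilator {M : Subalgebra ℂ (H →L[ℂ] H)}
    {u : NormalProjTensor (wstarPredual M)}
    (hu : IsNormalVirtualDiagonal (wstarPredual_mulSeparatelyNormal M) u)
    {N : VonNeumannAlgebra H} {γ : ℝ} (hγ : 0 ≤ γ)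
    (h : NearInclusion γ (Subalgebra.toSubmodule M)
      (Subalgebra.toSubmodule N.toStarSubalgebra.toSubalgebra))
    {n : ℕ} {x : Matrix (Fin n) (Fin n) (H →L[ℂ] H)} (hx : ∀ j k, x j k ∈ M)
    {ι : Type u} [Fintype ι] {a b : Fin n → PiLp 2 (fun _ : ι => H)}
    (hab : ∀ j k, ∀ y ∈ N, ⟪a j, ampl ι y (b k)⟫_ℂ = 0) :
    ‖∑ j, ∑ k, ⟪a j, ampl ι (x j k) (b k)⟫_ℂ‖ ≤
      4 * ‖u‖ * γ * ‖matrixOp n x‖ * (√(∑ j, ‖a j‖ ^ 2) * √(∑ k, ‖b k‖ ^ 2)) := by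
  obtain ⟨p, hp1, hpN, hpb, hpa⟩ := exists_projection_of_annihilator N hab
  obtain ⟨Z, hZ, hZc⟩ := exists_implementing_operator_ampl hu (p := p) (C := 2 * γ) (by positivity)
    fun y hy => norm_commutator_le_of_nearInclusion h hp1 hpN hy
  -- $\langle a_j,(x\otimes 1)pb_k\rangle=\langle a_j,(x\otimes 1)b_k\rangle$, while $\langle
  -- a_j,p(x\otimes 1)b_k\rangle=0$.
  have hc : ∑ j, ∑ k, ⟪a j, ampl ι (x j k) (b k)⟫_ℂ =
      ∑ j, ∑ k, ⟪a j, (ampl ι (x j k) * Z - Z * ampl ι (x j k)) (b k)⟫_ℂ := by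
    refine Finset.sum_congr rfl fun j _ => Finset.sum_congr rfl fun k _ => ?_
    rw [hZc _ (hx j k), sub_apply, inner_sub_right, mul_apply_eq_comp, mul_apply_eq_comp, hpb, hpa,
      sub_zero]
  rw [hc]
  refine (norm_sum_inner_commutator_le x a b Z).trans ?_
  refine mul_le_mul_of_nonneg_right (mul_le_mul_of_nonneg_right ?_ (norm_nonneg _)) (by positivity)
  linarith

end Distance

end

theorem lemma5p4 {H : Type*} [NormedAddCommGroup H] [InnerProductSpace ℂ H] [CompleteSpace H]
    (M : Subalgebra ℂ (H →L[ℂ] H))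
    (hM : IsClosed[ultraweakTopology H] (M : Set (H →L[ℂ] H)))
    (u : NormalProjTensor (wstarPredual M))
    (hu : IsNormalVirtualDiagonal (wstarPredual_mulSeparatelyNormal M) u)
    (N : VonNeumannAlgebra H) (hN : N.IsInjective)
    (γ : ℝ) (hγ : 0 < γ)
    (h : NearInclusion γ (Subalgebra.toSubmodule M)
      (Subalgebra.toSubmodule N.toStarSubalgebra.toSubalgebra)) :
    NearCBInclusion (4 * ‖u‖ * γ) (Subalgebra.toSubmodule M)
      (Subalgebra.toSubmodule N.toStarSubalgebra.toSubalgebra) := by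
  rintro n _ ⟨x, hx, rfl⟩ hx1
  have hr : 0 ≤ 4 * ‖u‖ * γ := mul_nonneg (mul_nonneg (by norm_num) (norm_nonneg u)) hγ.le
  refine exists_mem_matrixSubspace_norm_sub_le N hr fun ι _ a b hab => ?_
  -- The factor $\|x\|\le 1$ is dropped.
  refine (norm_sum_inner_ampl_le_of_annihilator hu hγ.le h hx hab).trans ?_
  exact mul_le_mul_of_nonneg_right (mul_le_of_le_one_right hr hx1)
    (mul_nonneg (Real.sqrt_nonneg _) (Real.sqrt_nonneg _))
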